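/- Let $A=\{v_1,v_2\}$, $B=\{v_3,v_4\}$, $C=\{v_5,v_6\}$, $D=\{v_7,v_8\}$. The Vamos matroid on $\{v_1,\dots,v_8\}$ is the matroid whose independent sets are all sets of fewer than five elements except $A\cup B$, $A\cup C$, $B\cup C$, $B\cup D$ and $C\cup D$. Fix a dealer $d\in C$ (by symmetry one may take $d=v_6$; the resulting access structure is called $V_6$). Regard $d$ as a participant who is individually qualified: a set $X\subseteq\{v_1,\dots,v_8\}$ is qualified if $d\in X$, or if $X$ contains a set $Y$ with $d\notin Y$ such that $Y\cup\{d\}$ is a circuit (a minimal dependent set) of the Vamos matroid. Let $S$ (the secret) and, for each $1\le i\le 8$, a share for $v_i$ be random variables with finitely many values on a common probability space. Write $H$ for Shannon entropy, $H(X)$ for the joint entropy of the shares of the members of $X$, and $H(S\mid X)=H(X\cup\{S\})-H(X)$. Suppose that $H(S)>0$ and that these variables form a perfect secret sharing scheme, that is, $H(S\mid X)=0$ for every qualified set $X$ and $H(S\mid X)=H(S)$ for every set $X$ that is not qualified. Put $h(v_i)=H(v_i)/H(S)$ and $$\lambda=\Bigl(\max_{1\le i\le 8}h(v_i)\Bigr)-1.$$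 Then $$\lambda\ \ge\ \frac{2}{17}.$$ -/

import Mathlib

open MeasureTheory

/-- The Shannon entropy (natural logarithm) of a random variable `X` with values in a finite set. -/
noncomputable def shannonEntropy {Ω α : Type*} [MeasurableSpace Ω] [Fintype α]
    (μ : Measure Ω) (X : Ω → α) : ℝ :=
  ∑ a, Real.negMulLog (μ.real (X ⁻¹' {a}))

/-- The joint random variable formed by the shares of all participants in `X`. -/
def jointShare {Ω P : Type*} {α : P → Type*} (share : ∀ p, Ω → α p) (X : Finset P) :
    Ω → (∀ p : X, α p) :=
  fun ω p => share p ω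

/-- The conditional entropy `H(S | X) = H({S} ∪ X) - H(X)` of the secret `S` given the shares of
the participants in `X`. -/
noncomputable def secretCondEntropy {Ω P σ : Type*} {α : P → Type*} [MeasurableSpace Ω]
    [DecidableEq P] [Fintype σ] [∀ p, Fintype (α p)]
    (μ : Measure Ω) (S : Ω → σ) (share : ∀ p, Ω → α p) (X : Finset P) : ℝ :=
  shannonEntropy μ (fun ω => (S ω, jointShare share X ω)) - shannonEntropy μ (jointShare share X)

/-- The random variables `S` (the secret) and `share p` (the share of the participant `p`) form a
perfect secret sharing scheme for the access structure `Γ`. -/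
structure IsPerfectScheme {Ω P σ : Type*} {α : P → Type*} [MeasurableSpace Ω]
    [DecidableEq P] [Fintype σ] [∀ p, Fintype (α p)]
    (μ : Measure Ω) (S : Ω → σ) (share : ∀ p, Ω → α p) (Γ : Set (Finset P)) : Prop where
  qualified : ∀ X ∈ Γ, secretCondEntropy μ S share X = 0
  unqualified : ∀ X ∉ Γ, secretCondEntropy μ S share X = shannonEntropy μ S

/-- The normalized entropy `h(X) = H(X) / H(S)` of a set `X` of participants. -/
noncomputable def normalizedEntropy {Ω P σ : Type*} {α : P → Type*} [MeasurableSpace Ω]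
    [DecidableEq P] [Fintype σ] [∀ p, Fintype (α p)]
    (μ : Measure Ω) (S : Ω → σ) (share : ∀ p, Ω → α p) (X : Finset P) : ℝ :=
  shannonEntropy μ (jointShare share X) / shannonEntropy μ S

/-- `λ`, the maximal normalized entropy of a single participant, minus one. -/
noncomputable def schemeLambda {Ω P σ : Type*} {α : P → Type*} [MeasurableSpace Ω]
    [DecidableEq P] [Fintype P] [Nonempty P] [Fintype σ] [∀ p, Fintype (α p)]
    (μ : Measure Ω) (S : Ω → σ) (share : ∀ p, Ω → α p) : ℝ :=
  Finset.univ.sup' Finset.univ_nonempty (fun p : P => normalizedEntropy μ S share {p}) - 1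

/-- The access structure induced by a matroid `M` and a dealer `d`, where the dealer is regarded
as a participant who is qualified alone: the other minimal qualified sets are the sets `Y` of
participants, `d ∉ Y`, for which `Y ∪ {d}` is a circuit of `M`. -/
def inducedAccessStructure {P : Type*} [DecidableEq P] (M : Matroid P) (d : P) :
    Set (Finset P) :=
  {X | d ∈ X ∨ ∃ Y ⊆ X, d ∉ Y ∧ M.IsCircuit ((insert d Y : Finset P) : Set P)}

/-- The element `i : Fin 8` stands for `v_{i+1}`. The pair `A = {v₁, v₂}`. -/
def vamosA : Finset (Fin 8) := {0, 1}

/-- The pair `B = {v₃, v₄}`. -/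
def vamosB : Finset (Fin 8) := {2, 3}

/-- The pair `C = {v₅, v₆}`. -/
def vamosC : Finset (Fin 8) := {4, 5}

/-- The pair `D = {v₇, v₈}`. -/
def vamosD : Finset (Fin 8) := {6, 7}

/-- The five dependent sets of size four: `AB`, `AC`, `BC`, `BD`, `CD`. -/
def vamosQuads : Finset (Finset (Fin 8)) :=
  {vamosA ∪ vamosB, vamosA ∪ vamosC, vamosB ∪ vamosC, vamosB ∪ vamosD, vamosC ∪ vamosD}

/-- Independence in the Vamos matroid. -/
def VamosIndep (I : Finset (Fin 8)) : Prop := I.card < 5 ∧ I ∉ vamosQuads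

set_option maxRecDepth 10000 in
theorem vamosQuads_card : ∀ Q ∈ vamosQuads, Q.card = 4 := by decide

set_option maxRecDepth 10000 in
theorem vamosQuads_inter :
    ∀ Q ∈ vamosQuads, ∀ R ∈ vamosQuads, Q ≠ R → (Q ∩ R).card ≤ 2 := by decide

set_option maxRecDepth 10000 in
theorem vamosIndep_empty : VamosIndep ∅ := ⟨by decide, by decide⟩

theorem vamosIndep_subset ⦃I J : Finset (Fin 8)⦄ (hJ : VamosIndep J) (hIJ : I ⊆ J) :
    VamosIndep I := by
  have hc := Finset.card_le_card hIJ
  refine ⟨lt_of_le_of_lt hc hJ.1, fun hI => ?_⟩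
  have h4 := vamosQuads_card I hI
  have := Finset.eq_of_subset_of_card_le hIJ (by have := hJ.1; omega)
  exact hJ.2 (this ▸ hI)

theorem vamosIndep_aug ⦃I J : Finset (Fin 8)⦄ (_hI : VamosIndep I) (hJ : VamosIndep J)
    (hlt : I.card < J.card) : ∃ e ∈ J, e ∉ I ∧ VamosIndep (insert e I) := by
  by_contra! hcon
  have hquad : ∀ e ∈ J, e ∉ I → insert e I ∈ vamosQuads := by
    intro e heJ heI
    by_contra hq
    refine hcon e heJ heI ⟨?_, hq⟩
    have := Finset.card_insert_of_notMem heI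
    have := hJ.1
    omega
  obtain ⟨e, heJ, heI⟩ := Finset.exists_mem_notMem_of_card_lt_card hlt
  have hQ := hquad e heJ heI
  have hcard := vamosQuads_card _ hQ
  rw [Finset.card_insert_of_notMem heI] at hcard
  by_cases hex : ∃ f ∈ J, f ∉ I ∧ f ≠ e
  · obtain ⟨f, hfJ, hfI, hfe⟩ := hex
    have hR := hquad f hfJ hfI
    have hne : insert e I ≠ insert f I := by
      intro h
      have : f ∈ insert e I := h ▸ Finset.mem_insert_self f I
      rcases Finset.mem_insert.1 this with h' | h'
      · exact hfe h'
      · exact hfI h'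
    have h2 := vamosQuads_inter _ hQ _ hR hne
    have h3 := Finset.card_le_card
      (Finset.subset_inter (Finset.subset_insert e I) (Finset.subset_insert f I))
    omega
  · push Not at hex
    have hsub : J ⊆ insert e I := by
      intro f hf
      by_cases hfI : f ∈ I
      · exact Finset.mem_insert_of_mem hfI
      · rw [hex f hf hfI]; exact Finset.mem_insert_self e I
    have heq := Finset.eq_of_subset_of_card_le hsub (by
      rw [Finset.card_insert_of_notMem heI]; omega)
    exact hJ.2 (heq ▸ hQ)

/-- The Vamos matroid. -/
def vamosMatroid : Matroid (Fin 8) :=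
  (IndepMatroid.ofFinset Set.univ VamosIndep vamosIndep_empty vamosIndep_subset
    vamosIndep_aug (fun _ _ => Set.subset_univ _)).matroid

theorem vamosMatroid_indep_iff (I : Finset (Fin 8)) :
    vamosMatroid.Indep (I : Set (Fin 8)) ↔ VamosIndep I :=
  IndepMatroid.ofFinset_indep Set.univ VamosIndep vamosIndep_empty vamosIndep_subset
    vamosIndep_aug (fun _ _ => Set.subset_univ _)

/-!
The entropy of the shares of a scheme satisfies information inequalities beyond those of Shannon,
while the rank function of the Vamos matroid violates some of them. If all shares had the entropy
of the secret, the normalized entropy would be this rank function; the violation therefore forces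
some share to be larger, and the argument below gives `λ ≥ 1 / 8`, which is more than `2 / 17`.

The non-Shannon ingredient is the copy lemma `exists_copy`: on a suitable extension of the
probability space there is a variable `Z` that has the same joint law with `W` as a given `U`, and
that is conditionally independent of all the original variables given `W`. It is applied with
`U = {v₁, v₂}` and `W = {v₃, v₄, v₅, S}`, where `S` is the secret of the dealer `v₆`. The Shannon
inequalities for the enlarged family, the equations `H(S | X) = 0` or `H(S | X) = H(S)` and the
bounds `H(vᵢ) ≤ m` for the single shares then combine linearly to `9 H(S) ≤ 8 m`, in
`nine_mul_le_of_copy`. The other dealer `v₅` is treated by the automorphism of the Vamos matroid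
that exchanges `v₅` and `v₆`.

Up to relabelling its values, a random variable on a finite probability space is a partition of
this space, and joint variables are infima of partitions. Entropy is accordingly treated as a
function on `Setoid α` for a weighted finite type `α`. The space extending `α` in the copy lemma is
`α × α` with the law of two outcomes that agree on `W` and are conditionally independent given it:
the first coordinate carries the original variables and the second one the copy.
-/

/-! ### Entropy of a partition of a finite weighted set -/

section PartitionEntropy

variable {α : Type*} [Fintype α]

open Classical in
/-- The total weight of the class of `a` in the partition `s`. -/
noncomputable def classMass (p : α → ℝ) (s : Setoid α) (a : α) : ℝ :=
  ∑ b with s a b, p b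

/-- The Shannon entropy of the partition of `(α, p)` into the classes of `s`, written as a sum over
the points of `α` rather than over the classes. -/
noncomputable def partitionEntropy (p : α → ℝ) (s : Setoid α) : ℝ :=
  ∑ a, -(p a * Real.log (classMass p s a))

theorem classMass_congr (p : α → ℝ) {s : Setoid α} {a b : α} (h : s a b) :
    classMass p s a = classMass p s b := by
  classical
  unfold classMass
  refine Finset.sum_congr (Finset.filter_congr fun c _ => ?_) fun _ _ => rfl
  exact ⟨fun hc => s.trans (s.symm h) hc, fun hc => s.trans h hc⟩

theorem classMass_nonneg {p : α → ℝ} (hp : ∀ a, 0 ≤ p a) (s : Setoid α) (a : α) :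
    0 ≤ classMass p s a :=
  Finset.sum_nonneg fun b _ => hp b

theorem le_classMass {p : α → ℝ} (hp : ∀ a, 0 ≤ p a) (s : Setoid α) (a : α) :
    p a ≤ classMass p s a := by
  classical
  exact Finset.single_le_sum (f := p) (fun b _ => hp b) (by simp)

theorem classMass_mono {p : α → ℝ} (hp : ∀ a, 0 ≤ p a) {s t : Setoid α} (h : s ≤ t) (a : α) :
    classMass p s a ≤ classMass p t a := by
  classical
  unfold classMass
  refine Finset.sum_le_sum_of_subset_of_nonneg (fun b hb => ?_) fun b _ _ => hp b
  simp only [Finset.mem_filter, Finset.mem_univ, true_and] at hb ⊢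
  exact h hb

theorem partitionEntropy_anti {p : α → ℝ} (hp : ∀ a, 0 ≤ p a) {s t : Setoid α} (h : s ≤ t) :
    partitionEntropy p t ≤ partitionEntropy p s := by
  refine Finset.sum_le_sum fun a _ => neg_le_neg ?_
  rcases (hp a).eq_or_lt with h0 | h0
  · simp [← h0]
  · exact mul_le_mul_of_nonneg_left
      (Real.log_le_log (h0.trans_le (le_classMass hp s a)) (classMass_mono hp h a)) h0.le

theorem partitionEntropy_top {p : α → ℝ} (hp1 : ∑ a, p a = 1) :
    partitionEntropy p (⊤ : Setoid α) = 0 := by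
  classical
  have h : ∀ a, classMass p (⊤ : Setoid α) a = 1 := fun a => by
    rw [← hp1]
    exact Finset.sum_congr (Finset.filter_true_of_mem fun _ _ => trivial) fun _ _ => rfl
  simp [partitionEntropy, h]

/-- The entropy of a partition only depends on its restriction to the support of the weight. -/
theorem partitionEntropy_congr_support {p : α → ℝ} {s t : Setoid α}
    (h : ∀ a b, p a ≠ 0 → p b ≠ 0 → (s a b ↔ t a b)) :
    partitionEntropy p s = partitionEntropy p t := by
  classical
  refine Finset.sum_congr rfl fun a _ => ?_
  by_cases ha : p a = 0
  · simp [ha]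
  congr 3
  unfold classMass
  rw [Finset.sum_filter, Finset.sum_filter]
  refine Finset.sum_congr rfl fun b _ => ?_
  by_cases hb : p b = 0
  · simp [hb]
  · simp only [h a b ha hb]

open Classical in
/-- The points in the `s`-class of `c` and the `t`-class of `b` form one class of `s ⊓ t`, or none
at all; so the sum of the conditional weights in that class is at most `1`. -/
theorem sum_div_classMass_inf_le {p : α → ℝ} (hp : ∀ a, 0 ≤ p a) {s t k : Setoid α}
    (hs : s ≤ k) (ht : t ≤ k) (b c : α) :
    (∑ a with s a c ∧ t a b, p a / (classMass p (s ⊓ t) a * classMass p k a)) ≤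
      if k b c then 1 / classMass p k b else 0 := by
  rcases (Finset.univ.filter fun a => s a c ∧ t a b).eq_empty_or_nonempty with he | ⟨a₀, ha₀⟩
  · rw [he, Finset.sum_empty]
    split_ifs
    · exact one_div_nonneg.2 (classMass_nonneg hp k b)
    · exact le_rfl
  · simp only [Finset.mem_filter, Finset.mem_univ, true_and] at ha₀
    rw [if_pos (k.trans (k.symm (ht ha₀.2)) (hs ha₀.1))]
    have hterm : ∀ a ∈ Finset.univ.filter (fun a => s a c ∧ t a b),
        p a / (classMass p (s ⊓ t) a * classMass p k a) =
          p a / (classMass p (s ⊓ t) a₀ * classMass p k b) := by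
      intro a ha
      simp only [Finset.mem_filter, Finset.mem_univ, true_and] at ha
      have h1 : (s ⊓ t) a a₀ := ⟨s.trans ha.1 (s.symm ha₀.1), t.trans ha.2 (t.symm ha₀.2)⟩
      rw [classMass_congr p h1, classMass_congr p (ht ha.2)]
    have hsum : (∑ a with s a c ∧ t a b, p a) = classMass p (s ⊓ t) a₀ := by
      unfold classMass
      refine Finset.sum_congr (Finset.filter_congr fun a _ => ⟨fun ha => ?_, fun ha => ?_⟩)
        fun _ _ => rfl
      · exact ⟨s.trans ha₀.1 (s.symm ha.1), t.trans ha₀.2 (t.symm ha.2)⟩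
      · exact ⟨s.trans (s.symm ha.1) ha₀.1, t.trans (t.symm ha.2) ha₀.2⟩
    rw [Finset.sum_congr rfl hterm, ← Finset.sum_div, hsum]
    rcases eq_or_ne (classMass p (s ⊓ t) a₀) 0 with h0 | h0
    · rw [h0, zero_div]
      exact one_div_nonneg.2 (classMass_nonneg hp k b)
    · rw [div_mul_eq_div_div, div_self h0]

/-- The product of the conditional laws of `s` and `t` given `k`, evaluated on the support of `p`,
has total weight at most that of `p`. -/
theorem sum_mul_classMass_ratio_le {p : α → ℝ} (hp : ∀ a, 0 ≤ p a) {s t k : Setoid α}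
    (hs : s ≤ k) (ht : t ≤ k) :
    ∑ a, p a * (classMass p s a * classMass p t a /
      (classMass p (s ⊓ t) a * classMass p k a)) ≤ ∑ a, p a := by
  classical
  calc ∑ a, p a * (classMass p s a * classMass p t a /
        (classMass p (s ⊓ t) a * classMass p k a))
      = ∑ a, ∑ b, ∑ c, p b * p c * (if s a c ∧ t a b then
          p a / (classMass p (s ⊓ t) a * classMass p k a) else 0) := by
        refine Finset.sum_congr rfl fun a _ => ?_
        have e : p a * (classMass p s a * classMass p t a /
            (classMass p (s ⊓ t) a * classMass p k a)) =
            classMass p t a * classMass p s a *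
              (p a / (classMass p (s ⊓ t) a * classMass p k a)) := by ring
        rw [e]
        generalize p a / (classMass p (s ⊓ t) a * classMass p k a) = y
        unfold classMass
        rw [Finset.sum_filter, Finset.sum_filter, Finset.sum_mul_sum, Finset.sum_mul]
        refine Finset.sum_congr rfl fun b _ => ?_
        rw [Finset.sum_mul]
        refine Finset.sum_congr rfl fun c _ => ?_
        by_cases h1 : s a c <;> by_cases h2 : t a b <;> simp [h1, h2]
    _ = ∑ b, ∑ c, p b * p c * ∑ a with s a c ∧ t a b,
          p a / (classMass p (s ⊓ t) a * classMass p k a) := by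
        rw [Finset.sum_comm]
        refine Finset.sum_congr rfl fun b _ => ?_
        rw [Finset.sum_comm]
        refine Finset.sum_congr rfl fun c _ => ?_
        rw [Finset.sum_filter, Finset.mul_sum]
    _ ≤ ∑ b, ∑ c, p b * p c * (if k b c then 1 / classMass p k b else 0) :=
        Finset.sum_le_sum fun b _ => Finset.sum_le_sum fun c _ =>
          mul_le_mul_of_nonneg_left (sum_div_classMass_inf_le hp hs ht b c)
            (mul_nonneg (hp b) (hp c))
    _ = ∑ b, p b * (classMass p k b / classMass p k b) := by
        refine Finset.sum_congr rfl fun b _ => ?_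
        change _ = p b * ((∑ c with k b c, p c) / classMass p k b)
        rw [Finset.sum_filter, Finset.sum_div, Finset.mul_sum]
        refine Finset.sum_congr rfl fun c _ => ?_
        by_cases h : k b c
        · rw [if_pos h, if_pos h]; ring
        · simp [h]
    _ ≤ ∑ b, p b := Finset.sum_le_sum fun b _ =>
        mul_le_of_le_one_right (hp b) (div_self_le_one _)

/-- Submodularity of entropy: the conditional mutual information of `s` and `t` given a common
coarsening `k` is nonnegative. -/
theorem partitionEntropy_submodular {p : α → ℝ} (hp : ∀ a, 0 ≤ p a) {s t k : Setoid α}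
    (hs : s ≤ k) (ht : t ≤ k) :
    partitionEntropy p (s ⊓ t) + partitionEntropy p k ≤
      partitionEntropy p s + partitionEntropy p t := by
  have hpt : ∀ a, p a * (Real.log (classMass p s a) + Real.log (classMass p t a) -
      Real.log (classMass p (s ⊓ t) a) - Real.log (classMass p k a)) ≤
      p a * (classMass p s a * classMass p t a /
        (classMass p (s ⊓ t) a * classMass p k a)) - p a := by
    intro a
    rcases (hp a).eq_or_lt with h0 | h0
    · simp [← h0]
    · have h1 := h0.trans_le (le_classMass hp s a)
      have h2 := h0.trans_le (le_classMass hp t a)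
      have h3 := h0.trans_le (le_classMass hp (s ⊓ t) a)
      have h4 := h0.trans_le (le_classMass hp k a)
      have h5 := Real.log_le_sub_one_of_pos (div_pos (mul_pos h1 h2) (mul_pos h3 h4))
      rw [Real.log_div (mul_pos h1 h2).ne' (mul_pos h3 h4).ne', Real.log_mul h1.ne' h2.ne',
        Real.log_mul h3.ne' h4.ne'] at h5
      have := mul_le_mul_of_nonneg_left h5 h0.le
      linarith
  have hsum := Finset.sum_le_sum fun a (_ : a ∈ Finset.univ) => hpt a
  rw [Finset.sum_sub_distrib] at hsum
  have hle := sum_mul_classMass_ratio_le hp hs ht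
  have e : partitionEntropy p (s ⊓ t) + partitionEntropy p k -
      (partitionEntropy p s + partitionEntropy p t) =
      ∑ a, p a * (Real.log (classMass p s a) + Real.log (classMass p t a) -
        Real.log (classMass p (s ⊓ t) a) - Real.log (classMass p k a)) := by
    simp only [partitionEntropy, ← Finset.sum_add_distrib, ← Finset.sum_sub_distrib]
    exact Finset.sum_congr rfl fun a _ => by ring
  linarith

end PartitionEntropy

/-! ### The copy lemma -/

section Copy

variable {α : Type*} [Fintype α]

open Classical in
/-- The law on `α × α` of two outcomes of the weight `p` that lie in the same class of `w` and are
conditionally independent given this class. -/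
noncomputable def condIndepCopy (p : α → ℝ) (w : Setoid α) (x : α × α) : ℝ :=
  if w x.1 x.2 then p x.1 * p x.2 / classMass p w x.1 else 0

theorem condIndepCopy_nonneg {p : α → ℝ} (hp : ∀ a, 0 ≤ p a) (w : Setoid α) (x : α × α) :
    0 ≤ condIndepCopy p w x := by
  unfold condIndepCopy
  split_ifs
  · exact div_nonneg (mul_nonneg (hp _) (hp _)) (classMass_nonneg hp w _)
  · exact le_rfl

theorem rel_of_condIndepCopy_ne_zero {p : α → ℝ} {w : Setoid α} {x : α × α}
    (h : condIndepCopy p w x ≠ 0) : w x.1 x.2 := by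
  by_contra hx
  exact h (if_neg hx)

theorem condIndepCopy_swap (p : α → ℝ) (w : Setoid α) (a b : α) :
    condIndepCopy p w (b, a) = condIndepCopy p w (a, b) := by
  unfold condIndepCopy
  by_cases h : w a b
  · rw [if_pos h, if_pos (w.symm h)]
    simp only
    rw [classMass_congr p h, mul_comm]
  · rw [if_neg h, if_neg fun h' => h (w.symm h')]

theorem sum_condIndepCopy_right {p : α → ℝ} (hp : ∀ a, 0 ≤ p a) (w : Setoid α) (a : α) :
    ∑ b, condIndepCopy p w (a, b) = p a := by
  classical
  have e : ∑ b, condIndepCopy p w (a, b) = p a * (∑ b with w a b, p b) / classMass p w a := by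
    rw [Finset.sum_filter, Finset.mul_sum, Finset.sum_div]
    refine Finset.sum_congr rfl fun b _ => ?_
    unfold condIndepCopy
    by_cases h : w a b <;> simp [h]
  rw [e]
  change p a * classMass p w a / classMass p w a = p a
  rcases (hp a).eq_or_lt with h0 | h0
  · simp [← h0]
  · exact mul_div_cancel_right₀ _ (h0.trans_le (le_classMass hp w a)).ne'

theorem sum_condIndepCopy_left {p : α → ℝ} (hp : ∀ a, 0 ≤ p a) (w : Setoid α) (b : α) :
    ∑ a, condIndepCopy p w (a, b) = p b := by
  rw [← sum_condIndepCopy_right hp w b]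
  exact Finset.sum_congr rfl fun a _ => condIndepCopy_swap p w b a

theorem sum_condIndepCopy_mul_fst {p : α → ℝ} (hp : ∀ a, 0 ≤ p a) (w : Setoid α) (F : α → ℝ) :
    ∑ x, condIndepCopy p w x * F x.1 = ∑ a, p a * F a := by
  rw [Fintype.sum_prod_type]
  refine Finset.sum_congr rfl fun a _ => ?_
  simp only
  rw [← Finset.sum_mul, sum_condIndepCopy_right hp]

theorem sum_condIndepCopy_mul_snd {p : α → ℝ} (hp : ∀ a, 0 ≤ p a) (w : Setoid α) (F : α → ℝ) :
    ∑ x, condIndepCopy p w x * F x.2 = ∑ a, p a * F a := by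
  rw [Fintype.sum_prod_type, Finset.sum_comm]
  refine Finset.sum_congr rfl fun b _ => ?_
  simp only
  rw [← Finset.sum_mul, sum_condIndepCopy_left hp]

theorem classMass_condIndepCopy_fst {p : α → ℝ} (hp : ∀ a, 0 ≤ p a) (w s : Setoid α)
    (x : α × α) :
    classMass (condIndepCopy p w) (s.comap Prod.fst) x = classMass p s x.1 := by
  classical
  have h := sum_condIndepCopy_mul_fst hp w fun a => if s x.1 a then 1 else 0
  simp only [mul_ite, mul_one, mul_zero] at h
  unfold classMass
  rw [Finset.sum_filter, Finset.sum_filter]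
  exact h

theorem classMass_condIndepCopy_snd {p : α → ℝ} (hp : ∀ a, 0 ≤ p a) (w s : Setoid α)
    (x : α × α) :
    classMass (condIndepCopy p w) (s.comap Prod.snd) x = classMass p s x.2 := by
  classical
  have h := sum_condIndepCopy_mul_snd hp w fun a => if s x.2 a then 1 else 0
  simp only [mul_ite, mul_one, mul_zero] at h
  unfold classMass
  rw [Finset.sum_filter, Finset.sum_filter]
  exact h

theorem partitionEntropy_condIndepCopy_fst {p : α → ℝ} (hp : ∀ a, 0 ≤ p a) (w s : Setoid α) :
    partitionEntropy (condIndepCopy p w) (s.comap Prod.fst) = partitionEntropy p s := by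
  simp only [partitionEntropy, classMass_condIndepCopy_fst hp, Finset.sum_neg_distrib]
  rw [sum_condIndepCopy_mul_fst hp w fun a => Real.log (classMass p s a)]

theorem partitionEntropy_condIndepCopy_snd {p : α → ℝ} (hp : ∀ a, 0 ≤ p a) (w s : Setoid α) :
    partitionEntropy (condIndepCopy p w) (s.comap Prod.snd) = partitionEntropy p s := by
  simp only [partitionEntropy, classMass_condIndepCopy_snd hp, Finset.sum_neg_distrib]
  rw [sum_condIndepCopy_mul_snd hp w fun a => Real.log (classMass p s a)]

/-- For a partition coarser than `w` the two outcomes agree almost surely. -/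
theorem comap_fst_iff_comap_snd {p : α → ℝ} {w s : Setoid α} (hs : w ≤ s) {x y : α × α}
    (hx : condIndepCopy p w x ≠ 0) (hy : condIndepCopy p w y ≠ 0) :
    s.comap Prod.fst x y ↔ s.comap Prod.snd x y := by
  have h1 := hs (rel_of_condIndepCopy_ne_zero hx)
  have h2 := hs (rel_of_condIndepCopy_ne_zero hy)
  exact ⟨fun h => s.trans (s.symm h1) (s.trans h h2),
    fun h => s.trans h1 (s.trans h (s.symm h2))⟩

/-- A variable of the second outcome has the same joint law with the functions of `w` as the
corresponding variable of the first one. -/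
theorem partitionEntropy_condIndepCopy_of_le {p : α → ℝ} (hp : ∀ a, 0 ≤ p a) {w s : Setoid α}
    (hs : w ≤ s) (t : Setoid α) :
    partitionEntropy (condIndepCopy p w) (s.comap Prod.fst ⊓ t.comap Prod.snd) =
      partitionEntropy p (s ⊓ t) := by
  rw [← partitionEntropy_condIndepCopy_snd hp w (s ⊓ t)]
  refine partitionEntropy_congr_support fun x y hx hy => ?_
  exact and_congr_left fun _ => comap_fst_iff_comap_snd hs hx hy

theorem classMass_condIndepCopy_inf {p : α → ℝ} {w s t : Setoid α}
    (hs : s ≤ w) (ht : t ≤ w) {x : α × α} (hx : w x.1 x.2) :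
    classMass (condIndepCopy p w) (s.comap Prod.fst ⊓ t.comap Prod.snd) x =
      classMass p s x.1 * classMass p t x.2 / classMass p w x.1 := by
  classical
  unfold classMass
  rw [Finset.sum_filter, Fintype.sum_prod_type, Finset.sum_filter, Finset.sum_filter,
    Finset.sum_mul_sum, Finset.sum_div]
  refine Finset.sum_congr rfl fun a _ => ?_
  rw [Finset.sum_div]
  refine Finset.sum_congr rfl fun b _ => ?_
  by_cases h1 : s x.1 a
  · by_cases h2 : t x.2 b
    · have h : (s.comap Prod.fst ⊓ t.comap Prod.snd : Setoid (α × α)) x (a, b) := ⟨h1, h2⟩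
      have hab : w a b := w.trans (w.symm (hs h1)) (w.trans hx (ht h2))
      rw [if_pos h, if_pos h1, if_pos h2]
      change condIndepCopy p w (a, b) = p a * p b / classMass p w x.1
      rw [classMass_congr p (hs h1)]
      exact if_pos hab
    · rw [if_neg fun h => h2 h.2, if_neg h2]; simp
  · rw [if_neg fun h => h1 h.1, if_neg h1]; simp

/-- The two outcomes are conditionally independent given `w`, which `s` refines. -/
theorem partitionEntropy_condIndepCopy_of_ge {p : α → ℝ} (hp : ∀ a, 0 ≤ p a) {w s : Setoid α}
    (hs : s ≤ w) (t : Setoid α) :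
    partitionEntropy (condIndepCopy p w) (s.comap Prod.fst ⊓ t.comap Prod.snd) =
      partitionEntropy p s + partitionEntropy p (w ⊓ t) - partitionEntropy p w := by
  have e : partitionEntropy (condIndepCopy p w) (s.comap Prod.fst ⊓ t.comap Prod.snd) =
      partitionEntropy (condIndepCopy p w) (s.comap Prod.fst ⊓ (w ⊓ t).comap Prod.snd) := by
    refine partitionEntropy_congr_support fun x y hx hy => ?_
    exact ⟨fun h => ⟨h.1, (comap_fst_iff_comap_snd le_rfl hx hy).1 (hs h.1), h.2⟩,
      fun h => ⟨h.1, h.2.2⟩⟩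
  rw [e]
  set u := w ⊓ t
  have hu : u ≤ w := inf_le_left
  have hterm : ∀ x, -(condIndepCopy p w x *
      Real.log (classMass (condIndepCopy p w) (s.comap Prod.fst ⊓ u.comap Prod.snd) x)) =
      -(condIndepCopy p w x * Real.log (classMass p s x.1)) +
      -(condIndepCopy p w x * Real.log (classMass p u x.2)) -
      -(condIndepCopy p w x * Real.log (classMass p w x.1)) := by
    intro x
    by_cases hx : condIndepCopy p w x = 0
    · simp [hx]
    have hw := rel_of_condIndepCopy_ne_zero hx
    have hpx : p x.1 * p x.2 / classMass p w x.1 ≠ 0 := by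
      rwa [condIndepCopy, if_pos hw] at hx
    have h1 : 0 < p x.1 := (hp _).lt_of_ne fun h => hpx (by rw [← h]; simp)
    have h2 : 0 < p x.2 := (hp _).lt_of_ne fun h => hpx (by rw [← h]; simp)
    have h3 := h1.trans_le (le_classMass hp s _)
    have h4 := h2.trans_le (le_classMass hp u _)
    have h5 := h1.trans_le (le_classMass hp w _)
    rw [classMass_condIndepCopy_inf hs hu hw, Real.log_div (mul_pos h3 h4).ne' h5.ne',
      Real.log_mul h3.ne' h4.ne']
    ring
  simp only [partitionEntropy]
  rw [Finset.sum_congr rfl fun x _ => hterm x, Finset.sum_sub_distrib, Finset.sum_add_distrib]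
  simp only [Finset.sum_neg_distrib]
  rw [sum_condIndepCopy_mul_fst hp w fun a => Real.log (classMass p s a),
    sum_condIndepCopy_mul_snd hp w fun a => Real.log (classMass p u a),
    sum_condIndepCopy_mul_fst hp w fun a => Real.log (classMass p w a)]

/-- The copy lemma. For a family `r` of partitions and its entropy function `f`, there is an
additional variable which has the joint law of `U` with respect to `W` and is conditionally
independent of all of `r` given `W`. The function `g` is the joint entropy of this variable
together with the members of a set. -/
theorem exists_copy {ι : Type*} [DecidableEq ι] {p : α → ℝ} (hp : ∀ a, 0 ≤ p a)
    (r : ι → Setoid α) {f : Finset ι → ℝ} (hf : ∀ X, f X = partitionEntropy p (X.inf r))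
    (U W : Finset ι) :
    ∃ g : Finset ι → ℝ,
      (∀ X ⊆ W, g X = f (X ∪ U)) ∧
      (∀ X, W ⊆ X → g X = f X + f (W ∪ U) - f W) ∧
      (∀ X Y, X ⊆ Y → g X ≤ g Y) ∧
      (∀ X Y, g (X ∪ Y) + g (X ∩ Y) ≤ g X + g Y) ∧
      (∀ X Y, g (X ∪ Y) + f (X ∩ Y) ≤ g X + f Y) := by
  set w := W.inf r
  have hq := condIndepCopy_nonneg hp w
  have hunion : ∀ X Y : Finset ι, ((X ∪ Y).inf r).comap (Prod.fst : α × α → α) =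
      (X.inf r).comap Prod.fst ⊓ (Y.inf r).comap Prod.fst := fun X Y => by
    rw [Finset.inf_union]; rfl
  have hanti : ∀ {X Y : Finset ι}, X ⊆ Y →
      (Y.inf r).comap (Prod.fst : α × α → α) ≤ (X.inf r).comap Prod.fst :=
    fun h _ _ hxy => Setoid.le_def.1 (Finset.inf_mono h) hxy
  refine ⟨fun X => partitionEntropy (condIndepCopy p w)
    ((X.inf r).comap Prod.fst ⊓ (U.inf r).comap Prod.snd), ?_, ?_, ?_, ?_, ?_⟩
  · intro X hX
    simp only
    rw [partitionEntropy_condIndepCopy_of_le hp (Finset.inf_mono hX), hf, Finset.inf_union]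
  · intro X hX
    simp only
    rw [partitionEntropy_condIndepCopy_of_ge hp (Finset.inf_mono hX), hf, hf, hf,
      Finset.inf_union]
  · intro X Y h
    exact partitionEntropy_anti hq (inf_le_inf_right _ (hanti h))
  · intro X Y
    simp only
    rw [hunion, inf_inf_distrib_right]
    exact partitionEntropy_submodular hq (inf_le_inf_right _ (hanti Finset.inter_subset_left))
      (inf_le_inf_right _ (hanti Finset.inter_subset_right))
  · intro X Y
    rw [hf, hf, ← partitionEntropy_condIndepCopy_fst hp w,
      ← partitionEntropy_condIndepCopy_fst hp w]
    simp only
    rw [hunion, inf_right_comm]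
    exact partitionEntropy_submodular hq
      (inf_le_left.trans (hanti Finset.inter_subset_left)) (hanti Finset.inter_subset_right)

end Copy

/-! ### The ports of the Vamos matroid at the pair `C` -/

instance decidablePredVamosIndep : DecidablePred VamosIndep := fun I =>
  inferInstanceAs (Decidable (I.card < 5 ∧ I ∉ vamosQuads))

theorem vamosMatroid_isCircuit_iff (C : Finset (Fin 8)) :
    vamosMatroid.IsCircuit (C : Set (Fin 8)) ↔
      ¬ VamosIndep C ∧ ∀ e ∈ C, VamosIndep (C.erase e) := by
  rw [Matroid.isCircuit_iff_dep_forall_sdiff_singleton_indep, ← Matroid.not_indep_iff (by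
    exact Set.subset_univ _), vamosMatroid_indep_iff]
  simp only [Finset.mem_coe, ← Finset.coe_erase, vamosMatroid_indep_iff]

theorem mem_inducedAccessStructure_vamosMatroid_iff (d : Fin 8) (X : Finset (Fin 8)) :
    X ∈ inducedAccessStructure vamosMatroid d ↔
      d ∈ X ∨ ∃ Y ∈ X.powerset, d ∉ Y ∧ ¬ VamosIndep (insert d Y) ∧
        ∀ e ∈ insert d Y, VamosIndep ((insert d Y).erase e) := by
  simp only [inducedAccessStructure, Set.mem_ofPred_eq, vamosMatroid_isCircuit_iff,
    Finset.mem_powerset]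

instance decidableMemVamosPort (d : Fin 8) (X : Finset (Fin 8)) :
    Decidable (X ∈ inducedAccessStructure vamosMatroid d) :=
  decidable_of_iff _ (mem_inducedAccessStructure_vamosMatroid_iff d X).symm

/-- An automorphism `e` of the matroid carries the port at `d` to the port at `e d`. -/
theorem map_mem_inducedAccessStructure_iff {P : Type*} [DecidableEq P] {M : Matroid P}
    (e : Equiv.Perm P)
    (he : ∀ C : Finset P, M.IsCircuit ((C.map e.toEmbedding : Finset P) : Set P) ↔
      M.IsCircuit (C : Set P)) (d : P) (X : Finset P) :
    X.map e.toEmbedding ∈ inducedAccessStructure M (e d) ↔ X ∈ inducedAccessStructure M d := by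
  have hd : ∀ Y : Finset P, e d ∈ Y.map e.toEmbedding ↔ d ∈ Y := fun Y =>
    Finset.mem_map' e.toEmbedding
  refine or_congr (hd X) ⟨?_, ?_⟩
  · rintro ⟨Y, hYX, hdY, hC⟩
    obtain ⟨Z, hZX, rfl⟩ := Finset.subset_map_iff.1 hYX
    refine ⟨Z, hZX, fun h => hdY ((hd Z).2 h), (he _).1 ?_⟩
    rwa [Finset.map_insert]
  · rintro ⟨Y, hYX, hdY, hC⟩
    refine ⟨Y.map e.toEmbedding, Finset.map_subset_map.2 hYX, fun h => hdY ((hd Y).1 h), ?_⟩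
    have h := (he _).2 hC
    rwa [Finset.map_insert] at h

set_option maxRecDepth 100000 in
/-- The transposition of `v₅` and `v₆` preserves the pair `C`, hence all five quadruples. -/
theorem vamosIndep_map_swap_iff : ∀ I : Finset (Fin 8),
    VamosIndep (I.map (Equiv.swap 4 5).toEmbedding) ↔ VamosIndep I := by
  have hC : ∀ Q ∈ vamosQuads, Q.map (Equiv.swap 4 5).toEmbedding = Q := by decide
  intro I
  have hI : (I.map (Equiv.swap 4 5).toEmbedding).map (Equiv.swap 4 5).toEmbedding = I := by
    ext x
    simp
  refine and_congr (by rw [Finset.card_map]) (not_congr ⟨fun h => ?_, fun h => ?_⟩)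
  · have h' := hC _ h
    rw [hI] at h'
    rwa [h']
  · rwa [hC I h]

theorem vamosMatroid_isCircuit_map_swap_iff (C : Finset (Fin 8)) :
    vamosMatroid.IsCircuit
      ((C.map (Equiv.swap 4 5).toEmbedding : Finset (Fin 8)) : Set (Fin 8)) ↔
      vamosMatroid.IsCircuit (C : Set (Fin 8)) := by
  rw [vamosMatroid_isCircuit_iff, vamosMatroid_isCircuit_iff, vamosIndep_map_swap_iff]
  refine and_congr_right fun _ => ⟨fun h e he => ?_, fun h e he => ?_⟩
  · have := h _ (Finset.mem_map_of_mem _ he)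
    rwa [← Finset.map_erase, vamosIndep_map_swap_iff] at this
  · obtain ⟨x, hx, rfl⟩ := Finset.mem_map.1 he
    rw [← Finset.map_erase, vamosIndep_map_swap_iff]
    exact h x hx

/-! ### The linear inequality -/

set_option maxRecDepth 100000 in
/-- The linear part of the bound for the dealer `v₆`, whose index `5` stands here for the secret.
The function `f` is the joint entropy of subsets of the secret and the seven other shares, and `g X`
is the joint entropy of `X` and a copy of `{v₁, v₂}` over `{v₃, v₄, v₅, S}`. The inequality is
obtained by adding the listed instances of the hypotheses with suitable multiplicities. -/
theorem nine_mul_le_of_copy {f g : Finset (Fin 8) → ℝ} {s m : ℝ}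
    (hf0 : f ∅ = 0)
    (hff : ∀ X Y, f (X ∪ Y) + f (X ∩ Y) ≤ f X + f Y)
    (hgmono : ∀ X Y, X ⊆ Y → g X ≤ g Y)
    (hgg : ∀ X Y, g (X ∪ Y) + g (X ∩ Y) ≤ g X + g Y)
    (hgf : ∀ X Y, g (X ∪ Y) + f (X ∩ Y) ≤ g X + f Y)
    (hcopy : ∀ X ⊆ ({2, 3, 4, 5} : Finset (Fin 8)), g X = f (X ∪ {0, 1}))
    (hindep : ∀ X, {2, 3, 4, 5} ⊆ X → g X = f X + f ({2, 3, 4, 5} ∪ {0, 1}) - f {2, 3, 4, 5})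
    (hqual : ∀ X ∈ inducedAccessStructure vamosMatroid 5, f (insert 5 X) = f X)
    (hunqual : ∀ X ∉ inducedAccessStructure vamosMatroid 5, f (insert 5 X) = f X + s)
    (hcap : ∀ i, i ≠ 5 → f {i} ≤ m) :
    9 * s ≤ 8 * m := by
  -- Restatements in which union and intersection are given in evaluated form.
  have ff : ∀ {X Y Z T : Finset (Fin 8)}, X ∪ Y = Z → X ∩ Y = T → f Z + f T ≤ f X + f Y := by
    rintro X Y _ _ rfl rfl
    exact hff X Y
  have gg : ∀ {X Y Z T : Finset (Fin 8)}, X ∪ Y = Z → X ∩ Y = T → g Z + g T ≤ g X + g Y := by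
    rintro X Y _ _ rfl rfl
    exact hgg X Y
  have gf : ∀ {X Y Z T : Finset (Fin 8)}, X ∪ Y = Z → X ∩ Y = T → g Z + f T ≤ g X + f Y := by
    rintro X Y _ _ rfl rfl
    exact hgf X Y
  have q : ∀ X Z : Finset (Fin 8), insert 5 X = Z →
      X ∈ inducedAccessStructure vamosMatroid 5 → f Z = f X := by
    rintro X _ rfl h
    exact hqual X h
  have u : ∀ X Z : Finset (Fin 8), insert 5 X = Z →
      X ∉ inducedAccessStructure vamosMatroid 5 → f Z = f X + s := by
    rintro X _ rfl h
    exact hunqual X h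
  have c : ∀ X Z : Finset (Fin 8), X ∪ {0, 1} = Z → X ⊆ {2, 3, 4, 5} → g X = f Z := by
    rintro X _ rfl h
    exact hcopy X h
  -- The copy has the joint law of `v₁, v₂` with `v₅` and `S`, and `{v₁, v₂, v₅}` is qualified; so
  -- the copy and `v₅` determine `S`.
  have gc : ∀ X Z : Finset (Fin 8), insert 5 X = Z → 4 ∈ X → g Z ≤ g X := by
    rintro X _ rfl h
    have h4 : ({4, 5} : Finset (Fin 8)) ∪ {0, 1} = insert 5 ({4} ∪ {0, 1}) := by decide
    have h0 := hqual ({4} ∪ {0, 1}) (by decide)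
    rw [← h4, ← hcopy _ (by decide), ← hcopy _ (by decide)] at h0
    have h1 := hgg X {4, 5}
    have h2 := hgmono {4} (X ∩ {4, 5}) (by simp [h])
    have h3 : X ∪ {4, 5} = insert 5 X := by
      ext x
      simp only [Finset.mem_union, Finset.mem_insert, Finset.mem_singleton]
      constructor
      · rintro (hx | rfl | rfl)
        exacts [Or.inr hx, Or.inr h, Or.inl rfl]
      · rintro (hx | hx)
        exacts [Or.inr (Or.inr hx), Or.inl hx]
    rw [h3] at h1
    linarith
  -- Submodularity for pairs of sets that do not involve the copy.
  have i1 : f {0, 1, 3, 4} + f {3, 4} ≤ f {0, 3, 4} + f {1, 3, 4} :=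
    ff (by decide) (by decide)
  have i2 : f {0, 4} + f ∅ ≤ f {0} + f {4} :=
    ff (by decide) (by decide)
  have i3 : f {2, 3, 4} + f ∅ ≤ f {4} + f {2, 3} :=
    ff (by decide) (by decide)
  have i4 : f {2, 3, 4} + f ∅ ≤ f {3, 4} + f {2} :=
    ff (by decide) (by decide)
  have i5 : f {4, 6, 7} + f ∅ ≤ f {4, 7} + f {6} :=
    ff (by decide) (by decide)
  have i6 : f {0, 1, 4} + f ∅ ≤ f {0, 4} + f {1} :=
    ff (by decide) (by decide)
  -- Submodularity for pairs in which the copy is joined to one of the two sets only.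
  have j1 : g {0, 1, 4, 5} + f {1, 4, 5} ≤ g {1, 4, 5} + f {0, 1, 4, 5} :=
    gf (by decide) (by decide)
  have j2 : g {4, 5, 6, 7} + f {4, 5, 7} ≤ g {4, 5, 7} + f {4, 5, 6, 7} :=
    gf (by decide) (by decide)
  have j3 : g {0, 1, 7} + f {0, 1} ≤ g {0, 1} + f {0, 1, 7} :=
    gf (by decide) (by decide)
  have j4 : g {0, 1, 2, 3, 4, 5, 6, 7} + f {0, 1, 5, 7} ≤
      g {0, 1, 5, 6, 7} + f {0, 1, 2, 3, 4, 5, 7} :=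
    gf (by decide) (by decide)
  have j5 : g {0, 1, 2, 3, 4, 5, 6, 7} + f {1, 3, 4, 5} ≤
      g {0, 1, 3, 4, 5} + f {1, 2, 3, 4, 5, 6, 7} :=
    gf (by decide) (by decide)
  have j6 : g {0, 1, 2, 3, 4, 5, 6, 7} + f {2, 3, 5, 6, 7} ≤
      g {0, 1, 2, 3, 5, 6, 7} + f {2, 3, 4, 5, 6, 7} :=
    gf (by decide) (by decide)
  have j7 : g {1, 4} + f ∅ ≤ g ∅ + f {1, 4} :=
    gf (by decide) (by decide)
  have j8 : g {0, 1, 2, 3} + f {2, 3} ≤ g {2, 3} + f {0, 1, 2, 3} :=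
    gf (by decide) (by decide)
  have j9 : g {4, 7} + f ∅ ≤ g {7} + f {4} :=
    gf (by decide) (by decide)
  have j10 : g {2, 3, 6, 7} + f {2, 3} ≤ g {2, 3} + f {2, 3, 6, 7} :=
    gf (by decide) (by decide)
  have j11 : g {0, 1, 2, 3, 4, 5, 6, 7} + f {0, 3, 4, 5} ≤
      g {0, 2, 3, 4, 5, 6, 7} + f {0, 1, 3, 4, 5} :=
    gf (by decide) (by decide)
  -- Submodularity for pairs in which the copy is joined to both sets.
  have k1 : g {0, 1, 3, 4} + g {0, 1} ≤ g {0, 1, 3} + g {0, 1, 4} :=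
    gg (by decide) (by decide)
  have k2 : g {0, 1, 2, 3, 4, 5, 6, 7} + g {2, 3, 5} ≤ g {0, 1, 2, 3, 5, 6, 7} + g {2, 3, 4, 5} :=
    gg (by decide) (by decide)
  have k3 : g {2, 3, 4, 6, 7} + g {6, 7} ≤ g {4, 6, 7} + g {2, 3, 6, 7} :=
    gg (by decide) (by decide)
  have k4 : g {0, 1, 6, 7} + g {7} ≤ g {6, 7} + g {0, 1, 7} :=
    gg (by decide) (by decide)
  have k5 : g {0, 1, 2, 3, 4, 6, 7} + g {0, 1, 3} ≤ g {0, 1, 3, 4, 6, 7} + g {0, 1, 2, 3} :=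
    gg (by decide) (by decide)
  -- Monotonicity of `g`.
  have m1 : g {1, 2, 3, 4, 5, 6, 7} ≤ g {0, 1, 2, 3, 4, 5, 6, 7} :=
    hgmono _ _ (by decide)
  have m2 : g {0, 2, 3, 4, 5, 6, 7} ≤ g {0, 1, 2, 3, 4, 5, 6, 7} :=
    hgmono _ _ (by decide)
  have m3 : g {0, 1, 3, 4, 5, 6, 7} ≤ g {0, 1, 2, 3, 4, 5, 6, 7} :=
    hgmono _ _ (by decide)
  have m4 : g {0, 1, 2, 3, 5, 6, 7} ≤ g {0, 1, 2, 3, 4, 5, 6, 7} :=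
    hgmono _ _ (by decide)
  have m5 : g {0, 1, 2, 3, 4, 5, 7} ≤ g {0, 1, 2, 3, 4, 5, 6, 7} :=
    hgmono _ _ (by decide)
  have m6 : g {0, 1, 4} ≤ g {0, 1, 4, 5} := hgmono _ _ (by decide)
  have m7 : g {0, 1, 3, 4, 6, 7} ≤ g {0, 1, 3, 4, 5, 6, 7} := hgmono _ _ (by decide)
  have m8 : g {4, 6, 7} ≤ g {4, 5, 6, 7} := hgmono _ _ (by decide)
  -- Qualified sets determine the secret.
  have q1 := q {0, 1, 2, 3, 4, 7} {0, 1, 2, 3, 4, 5, 7} (by decide) (by decide)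
  have q2 := q {0, 1, 3, 4} {0, 1, 3, 4, 5} (by decide) (by decide)
  have q3 := q {0, 1, 4} {0, 1, 4, 5} (by decide) (by decide)
  have q4 := q {1, 2, 3, 4, 6, 7} {1, 2, 3, 4, 5, 6, 7} (by decide) (by decide)
  have q5 := q {2, 3, 4, 6, 7} {2, 3, 4, 5, 6, 7} (by decide) (by decide)
  have q6 := q {4, 6, 7} {4, 5, 6, 7} (by decide) (by decide)
  have q7 := q {0, 1, 2, 3, 4} {0, 1, 2, 3, 4, 5} (by decide) (by decide)
  have q8 := q {2, 3, 4} {2, 3, 4, 5} (by decide) (by decide)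
  have q9 := q {0, 1, 6, 7} {0, 1, 5, 6, 7} (by decide) (by decide)
  -- A fortiori `{v₁, v₂, v₇, v₈}` together with the copy determines the secret.
  have gq : g {0, 1, 5, 6, 7} + f {0, 1, 6, 7} ≤ g {0, 1, 6, 7} + f {0, 1, 5, 6, 7} :=
    gf (by decide) (by decide)
  -- The copy and `v₅` determine the secret, as `v₁, v₂, v₅` do.
  have gc1 := gc {1, 4} {1, 4, 5} (by decide) (by decide)
  have gc2 := gc {4, 7} {4, 5, 7} (by decide) (by decide)
  have gc3 := gc {0, 1, 3, 4} {0, 1, 3, 4, 5} (by decide) (by decide)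
  have gc4 := gc {2, 3, 4, 6, 7} {2, 3, 4, 5, 6, 7} (by decide) (by decide)
  have gc5 := gc {0, 1, 2, 3, 4, 6, 7} {0, 1, 2, 3, 4, 5, 6, 7} (by decide) (by decide)
  -- Unqualified sets are independent of the secret.
  have u1 := u {0, 1, 7} {0, 1, 5, 7} (by decide) (by decide)
  have u2 := u {0, 3, 4} {0, 3, 4, 5} (by decide) (by decide)
  have u3 := u {1, 3, 4} {1, 3, 4, 5} (by decide) (by decide)
  have u4 := u {1, 4} {1, 4, 5} (by decide) (by decide)
  have u5 := u {2, 3, 6, 7} {2, 3, 5, 6, 7} (by decide) (by decide)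
  have u6 := u {4, 7} {4, 5, 7} (by decide) (by decide)
  have u7 := u {0, 1, 2, 3} {0, 1, 2, 3, 5} (by decide) (by decide)
  -- The joint law of the copy with `v₃, v₄, v₅, S`.
  have c1 := c {2, 3} {0, 1, 2, 3} (by decide) (by decide)
  have c2 := c ∅ {0, 1} (by decide) (by decide)
  have c3 := c {2, 3, 5} {0, 1, 2, 3, 5} (by decide) (by decide)
  have c4 := c {2, 3, 4, 5} {0, 1, 2, 3, 4, 5} (by decide) (by decide)
  have hW : ({2, 3, 4, 5} ∪ {0, 1} : Finset (Fin 8)) = {0, 1, 2, 3, 4, 5} := by decide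
  rw [hW] at hindep
  -- Conditional independence of the copy from the rest given `v₃, v₄, v₅, S`.
  have d1 := hindep {0, 1, 2, 3, 4, 5, 6, 7} (by decide)
  have d2 := hindep {0, 1, 2, 3, 4, 5, 7} (by decide)
  have d3 := hindep {1, 2, 3, 4, 5, 6, 7} (by decide)
  have d4 := hindep {2, 3, 4, 5, 6, 7} (by decide)
  -- The bounds on the single shares.
  have s1 := hcap 0 (by decide)
  have s2 := hcap 1 (by decide)
  have s3 := hcap 2 (by decide)
  have s4 := hcap 4 (by decide)
  have s5 := hcap 6 (by decide)
  -- Of these inequalities `i3` is taken twice, `k2` three times, `m4` and `s4` four times, and each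
  -- of the others once; the equations eliminate what remains.
  linarith

/-! ### Schemes given by partitions -/

theorem nine_mul_partitionEntropy_le_of_port_five {α : Type*} [Fintype α] {p : α → ℝ}
    (hp : ∀ a, 0 ≤ p a) (hp1 : ∑ a, p a = 1) (s : Setoid α) (r : Fin 8 → Setoid α) {m : ℝ}
    (hqual : ∀ X ∈ inducedAccessStructure vamosMatroid 5,
      partitionEntropy p (s ⊓ X.inf r) = partitionEntropy p (X.inf r))
    (hunqual : ∀ X ∉ inducedAccessStructure vamosMatroid 5,
      partitionEntropy p (s ⊓ X.inf r) = partitionEntropy p (X.inf r) + partitionEntropy p s)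
    (hcap : ∀ i, partitionEntropy p (r i) ≤ m) :
    9 * partitionEntropy p s ≤ 8 * m := by
  -- The dealer's own share plays no role, so its index is reused for the secret.
  set r' : Fin 8 → Setoid α := Function.update r 5 s
  have hne : ∀ i, i ≠ 5 → r' i = r i := fun i hi => Function.update_of_ne hi _ _
  have hinf : ∀ X : Finset (Fin 8), 5 ∉ X → X.inf r' = X.inf r := fun X hX =>
    Finset.inf_congr rfl fun i hi => hne i fun h => hX (h ▸ hi)
  have hins : ∀ X : Finset (Fin 8), (insert 5 X).inf r' = s ⊓ X.inf r' := fun X => by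
    rw [Finset.inf_insert, show r' 5 = s from Function.update_self _ _ _]
  obtain ⟨g, hcopy, hindep, hgmono, hgg, hgf⟩ := exists_copy hp r'
    (f := fun X => partitionEntropy p (X.inf r')) (fun _ => rfl) {0, 1} {2, 3, 4, 5}
  refine nine_mul_le_of_copy (f := fun X => partitionEntropy p (X.inf r')) (g := g)
    ?_ ?_ hgmono hgg hgf hcopy hindep ?_ ?_ ?_
  · simpa using partitionEntropy_top hp1
  · intro X Y
    rw [Finset.inf_union]
    exact partitionEntropy_submodular hp (Finset.inf_mono Finset.inter_subset_left)
      (Finset.inf_mono Finset.inter_subset_right)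
  · intro X hX
    by_cases h5 : 5 ∈ X
    · rw [Finset.insert_eq_of_mem h5]
    · rw [hins, hinf X h5, hqual X hX]
  · intro X hX
    rw [hins, hinf X fun h => hX (Or.inl h), hunqual X hX]
  · intro i hi
    rw [Finset.inf_singleton, hne i hi]
    exact hcap i

/-- The largest share has entropy at least `9 / 8` times that of the secret, for either dealer in
`C`; the dealer `v₅` is reduced to `v₆` by the symmetry exchanging the two. -/
theorem nine_mul_partitionEntropy_le_of_port {α : Type*} [Fintype α] {p : α → ℝ}
    (hp : ∀ a, 0 ≤ p a) (hp1 : ∑ a, p a = 1) (s : Setoid α) (r : Fin 8 → Setoid α) {m : ℝ}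
    {d : Fin 8} (hd : d ∈ vamosC)
    (hqual : ∀ X ∈ inducedAccessStructure vamosMatroid d,
      partitionEntropy p (s ⊓ X.inf r) = partitionEntropy p (X.inf r))
    (hunqual : ∀ X ∉ inducedAccessStructure vamosMatroid d,
      partitionEntropy p (s ⊓ X.inf r) = partitionEntropy p (X.inf r) + partitionEntropy p s)
    (hcap : ∀ i, partitionEntropy p (r i) ≤ m) :
    9 * partitionEntropy p s ≤ 8 * m := by
  have hd' : d = 4 ∨ d = 5 := by simpa [vamosC] using hd
  rcases hd' with rfl | rfl
  · have hmem : ∀ X : Finset (Fin 8), X.map (Equiv.swap 4 5).toEmbedding ∈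
        inducedAccessStructure vamosMatroid 4 ↔ X ∈ inducedAccessStructure vamosMatroid 5 :=
      map_mem_inducedAccessStructure_iff (Equiv.swap 4 5) vamosMatroid_isCircuit_map_swap_iff 5
    have hinf : ∀ X : Finset (Fin 8), X.inf (fun i => r (Equiv.swap 4 5 i)) =
        (X.map (Equiv.swap 4 5).toEmbedding).inf r := fun X => by
      rw [Finset.inf_map]
      rfl
    refine nine_mul_partitionEntropy_le_of_port_five hp hp1 s (fun i => r (Equiv.swap 4 5 i))
      (fun X hX => ?_) (fun X hX => ?_) fun i => hcap _
    · rw [hinf]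
      exact hqual _ ((hmem X).2 hX)
    · rw [hinf]
      exact hunqual _ fun h => hX ((hmem X).1 h)
  · exact nine_mul_partitionEntropy_le_of_port_five hp hp1 s r hqual hunqual hcap

/-! ### From random variables to partitions -/

/-- If `T` takes finitely many values, the entropy of a function of `T` is the entropy, for the law
of `T`, of the partition into the fibres of that function. -/
theorem shannonEntropy_comp {Ω α β : Type*} [MeasurableSpace Ω] (μ : Measure Ω)
    [IsProbabilityMeasure μ] [Fintype α] [Fintype β] {T : Ω → α}
    (hT : ∀ a, MeasurableSet (T ⁻¹' {a})) (φ : α → β) :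
    shannonEntropy μ (fun ω => φ (T ω)) =
      partitionEntropy (fun a => μ.real (T ⁻¹' {a})) (Setoid.ker φ) := by
  classical
  have hfib : ∀ b, μ.real ((fun ω => φ (T ω)) ⁻¹' {b}) =
      ∑ a with φ a = b, μ.real (T ⁻¹' {a}) := by
    intro b
    rw [sum_measureReal_preimage_singleton _ fun a _ => hT a]
    congr 1
    ext ω
    simp
  have hmass : ∀ a, classMass (fun a => μ.real (T ⁻¹' {a})) (Setoid.ker φ) a =
      ∑ a' with φ a' = φ a, μ.real (T ⁻¹' {a'}) := fun a =>
    Finset.sum_congr (Finset.filter_congr fun a' _ => eq_comm) fun _ _ => rfl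
  unfold shannonEntropy partitionEntropy
  rw [← Finset.sum_fiberwise Finset.univ φ]
  refine Finset.sum_congr rfl fun b _ => ?_
  rw [hfib, Real.negMulLog, Finset.sum_neg_distrib, neg_mul, Finset.sum_mul]
  congr 1
  refine Finset.sum_congr rfl fun a ha => ?_
  rw [hmass, (Finset.mem_filter.1 ha).2]

theorem finset_inf_setoid_apply {α ι : Type*} (r : ι → Setoid α) (X : Finset ι) (a b : α) :
    X.inf r a b ↔ ∀ i ∈ X, r i a b := by
  classical
  induction X using Finset.induction_on with
  | empty => exact iff_of_true trivial (by simp)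
  | insert i X _ ih =>
    rw [Finset.inf_insert, Finset.forall_mem_insert, ← ih]
    rfl

theorem ker_jointShare {Ω P : Type*} {α : P → Type*} (share : ∀ i, Ω → α i) (X : Finset P) :
    Setoid.ker (jointShare share X) = X.inf fun i => Setoid.ker (share i) := by
  ext a b
  rw [finset_inf_setoid_apply, Setoid.ker_def, funext_iff, Subtype.forall]
  rfl

/-! ### The lower bound on `λ` -/

theorem theoremC {Ω σ : Type*} {α : Fin 8 → Type*} [MeasurableSpace Ω]
    (μ : Measure Ω) [IsProbabilityMeasure μ]
    [Fintype σ] [MeasurableSpace σ] [MeasurableSingletonClass σ]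
    [∀ i, Fintype (α i)] [∀ i, MeasurableSpace (α i)] [∀ i, MeasurableSingletonClass (α i)]
    (S : Ω → σ) (hS : Measurable S)
    (share : ∀ i, Ω → α i) (hshare : ∀ i, Measurable (share i))
    (hpos : 0 < shannonEntropy μ S)
    (d : Fin 8) (hd : d ∈ vamosC)
    (hscheme : IsPerfectScheme μ S share (inducedAccessStructure vamosMatroid d)) :
    2 / 17 ≤ schemeLambda μ S share := by
  classical
  -- All variables are functions of the joint outcome, which takes finitely many values.
  let T : Ω → σ × (∀ i, α i) := fun ω => (S ω, fun i => share i ω)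
  have hT : ∀ a, MeasurableSet (T ⁻¹' {a}) := fun a =>
    (hS.prodMk (measurable_pi_lambda _ hshare)) (measurableSet_singleton a)
  set p : (σ × ∀ i, α i) → ℝ := fun a => μ.real (T ⁻¹' {a})
  let s : Setoid (σ × ∀ i, α i) := Setoid.ker Prod.fst
  let r : Fin 8 → Setoid (σ × ∀ i, α i) := fun i => Setoid.ker fun a => a.2 i
  have hp1 : ∑ a, p a = 1 := by
    rw [sum_measureReal_preimage_singleton _ fun a _ => hT a]
    simp
  have hHS : shannonEntropy μ S = partitionEntropy p s := shannonEntropy_comp μ hT Prod.fst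
  let sh : ∀ i, (σ × ∀ i, α i) → α i := fun i a => a.2 i
  have hHX : ∀ X : Finset (Fin 8), shannonEntropy μ (jointShare share X) =
      partitionEntropy p (X.inf r) := fun X =>
    (shannonEntropy_comp μ hT (jointShare sh X)).trans
      (congrArg (partitionEntropy p) (ker_jointShare sh X))
  have hHSX : ∀ X : Finset (Fin 8),
      shannonEntropy μ (fun ω => (S ω, jointShare share X ω)) =
        partitionEntropy p (s ⊓ X.inf r) := fun X => by
    have hker : Setoid.ker (fun a : σ × ∀ i, α i => (a.1, jointShare sh X a)) = s ⊓ X.inf r := by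
      rw [← ker_jointShare sh X]
      ext a b
      exact Prod.mk_inj
    rw [← hker]
    exact shannonEntropy_comp μ hT fun a => (a.1, jointShare sh X a)
  have hcap : ∀ i, partitionEntropy p (r i) ≤
      (schemeLambda μ S share + 1) * shannonEntropy μ S := fun i => by
    have h : normalizedEntropy μ S share {i} ≤ schemeLambda μ S share + 1 := by
      rw [schemeLambda, sub_add_cancel]
      exact Finset.le_sup' (fun i => normalizedEntropy μ S share {i}) (Finset.mem_univ i)
    rwa [normalizedEntropy, div_le_iff₀ hpos, hHX, Finset.inf_singleton] at h
  have key := nine_mul_partitionEntropy_le_of_port (fun a => measureReal_nonneg) hp1 s r hd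
    (fun X hX => by
      have h := hscheme.qualified X hX
      rw [secretCondEntropy, hHSX, hHX] at h
      exact sub_eq_zero.1 h)
    (fun X hX => by
      have h := hscheme.unqualified X hX
      rw [secretCondEntropy, hHSX, hHX, hHS] at h
      linarith) hcap
  rw [← hHS, ← mul_assoc] at key
  -- Now `9 ≤ 8 * (λ + 1)`, that is `1 / 8 ≤ λ`, which exceeds `2 / 17`.
  have := le_of_mul_le_mul_right key hpos
  linarith
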